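/- Let $k$ be a field of arbitrary characteristic, let $m\ge 6$ and $n=3m+2$, and let $S=k[a_i,b_i,c_i,d,e]_{i=1}^m$ be the polynomial ring in $n$ variables, where the indices $i$ are read modulo $m$. Let $P\subset \operatorname{Hom}_k(S,k)$ be the space of functionals that vanish on all sufficiently high powers of the ideal $S_+$ generated by the variables, with the contraction action $(s\cdot f)(t)=f(st)$ of $S$; for a monomial $\mathbf{x}$ of $S$ let $\mathbf{x}^{\vee}\in P$ be the functional with value $1$ on $\mathbf{x}$ and $0$ on every other monomial. For $f\in P$ put $\operatorname{Ann}(f)=\{s\in S: s\cdot f=0\}$ and $\operatorname{Apolar}(f)=S/\operatorname{Ann}(f)$. Consider the cubic $$F''=\sum_{i=1}^m \bigl(a_ib_ic_i + a_ia_{i+1}^2 + b_ib_{i+1}^2 + c_ic_{i+1}^2 + a_ib_{i+1}d + b_ic_{i+1}e\bigr),$$ and denote also by $F''$ its dual element in $P$, the image of $F''$ under the $k$-linear map $\mathbf{x}\mapsto \mathbf{x}^{\vee}$; it is homogeneous of degree $3$ (a linear combination of the $\mathbf{x}^{\vee}$ with $\deg\mathbf{x}=3$). Then $\operatorname{Apolar}(F'')$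 satisfies the small tangent space condition, that is, with $I=\operatorname{Ann}(F'')$ and $H(M)_i=\dim_k M_i$ for a graded module $M$: 1. $\operatorname{Apolar}(F'')=S/I$ has Hilbert function $(1,n,n,1)$, i.e. $H(S/I)_0=H(S/I)_3=1$, $H(S/I)_1=H(S/I)_2=n$, and $H(S/I)_i=0$ for $i\ge 4$; 2. $H(S/I^2)_4=n$ and $H(S/I^2)_5=0$. -/

import Mathlib

namespace Apolarity

open MvPolynomial

noncomputable section

variable (σ k : Type*) [Field k]

/-- The divided power module `P ⊆ S^∨ = Hom_k(S, k)` of the polynomial ring `S = k[σ]`: all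
functionals that vanish on every sufficiently high power of `S_+ = (α_i)_i`. -/
def DividedPower : Submodule k (Module.Dual k (MvPolynomial σ k)) where
  carrier := {f | ∃ N₀ : ℕ, ∀ N ≥ N₀, ∀ s ∈ idealOfVars σ k ^ N, f s = 0}
  zero_mem' := ⟨0, fun _ _ _ _ => rfl⟩
  add_mem' := by
    rintro f g ⟨N, hN⟩ ⟨M, hM⟩
    refine ⟨max N M, fun K hK s hs => ?_⟩
    simp [hN K (le_trans (le_max_left _ _) hK) s hs, hM K (le_trans (le_max_right _ _) hK) s hs]
  smul_mem' := by
    rintro c f ⟨N, hN⟩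
    refine ⟨N, fun K hK s hs => ?_⟩
    simp [hN K hK s hs]

variable {σ k}

/-- Contraction: the action of `s ∈ S` on `P` induced from `S^∨`, `(s · f)(t) = f (s t)`. -/
def contract (s : MvPolynomial σ k) (f : DividedPower σ k) : DividedPower σ k :=
  ⟨f.1 ∘ₗ LinearMap.mulLeft k s, by
    obtain ⟨N, hN⟩ := f.2
    exact ⟨N, fun K hK t ht => hN K hK (s * t) (Ideal.mul_mem_left _ s ht)⟩⟩

@[simp] theorem contract_apply (s t : MvPolynomial σ k) (f : DividedPower σ k) :
    (contract s f).1 t = f.1 (s * t) := rfl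

/-- The annihilator `Ann(f) = {s ∈ S : s · f = 0}`. -/
def Ann (f : DividedPower σ k) : Ideal (MvPolynomial σ k) where
  carrier := {s | contract s f = 0}
  zero_mem' := by
    apply Subtype.ext
    apply LinearMap.ext
    intro t
    simp
  add_mem' := by
    intro s s' hs hs'
    apply Subtype.ext
    apply LinearMap.ext
    intro t
    have h1 := congrArg (fun g : DividedPower σ k => g.1 t) hs
    have h2 := congrArg (fun g : DividedPower σ k => g.1 t) hs'
    simp only [contract_apply, ZeroMemClass.coe_zero, LinearMap.zero_apply] at h1 h2
    simp [add_mul, h1, h2]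
  smul_mem' := by
    intro r s hs
    apply Subtype.ext
    apply LinearMap.ext
    intro t
    have h1 := congrArg (fun g : DividedPower σ k => g.1 (r * t)) hs
    simp only [contract_apply, ZeroMemClass.coe_zero, LinearMap.zero_apply] at h1
    simp only [contract_apply, smul_eq_mul, ZeroMemClass.coe_zero, LinearMap.zero_apply]
    rw [← h1]
    congr 1
    ring

theorem mem_Ann {f : DividedPower σ k} {s : MvPolynomial σ k} :
    s ∈ Ann f ↔ contract s f = 0 := Iff.rfl

/-- The basis element `x^{[a]}` of `P`: the functional dual to the monomial `α^a`. -/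
def dualMonomial (a : σ →₀ ℕ) : DividedPower σ k :=
  ⟨lcoeff k a, a.degree + 1, fun N hN s hs => by
    have h := (mem_pow_idealOfVars_iff' N s).1 hs a (by omega)
    simpa using h⟩

theorem dualMonomial_monomial [DecidableEq σ] (a b : σ →₀ ℕ) :
    (dualMonomial a : DividedPower σ k).1 (monomial b 1) = if a = b then 1 else 0 := by
  simp [dualMonomial, coeff_monomial, eq_comm]

/-- `f ∈ P` is homogeneous of degree `d`. -/
def IsHomogeneousOfDegree (f : DividedPower σ k) (d : ℕ) : Prop :=
  f ∈ Submodule.span k {g : DividedPower σ k | ∃ a : σ →₀ ℕ, a.degree = d ∧ g = dualMonomial a}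

/-- The dual element in `P` of a polynomial: the `k`-linear extension of `α^a ↦ x^{[a]}`. -/
def dualElement : MvPolynomial σ k →ₗ[k] DividedPower σ k :=
  (basisMonomials σ k).constr k dualMonomial

/-- `H(S/J)_i`, for a homogeneous ideal `J`: the dimension over `k` of the degree `i` component
of `S/J`, that is, of the image of `S_i` in `S/J`. -/
def hilbertFunction (J : Ideal (MvPolynomial σ k)) (i : ℕ) : ℕ :=
  Module.finrank k
    ((homogeneousSubmodule σ k i).map (Ideal.Quotient.mkₐ k J).toLinearMap)

/-- The apolar algebra of a cubic `f ∈ P` satisfies the small tangent space condition; here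
`n = Nat.card σ` is the (finite) number of variables, `Apolar(f) = S/Ann(f)`. -/
structure SmallTangentSpaceCondition [Finite σ] (f : DividedPower σ k) : Prop where
  homogeneous : IsHomogeneousOfDegree f 3
  hilbert_zero : hilbertFunction (Ann f) 0 = 1
  hilbert_one : hilbertFunction (Ann f) 1 = Nat.card σ
  hilbert_two : hilbertFunction (Ann f) 2 = Nat.card σ
  hilbert_three : hilbertFunction (Ann f) 3 = 1
  hilbert_ge_four : ∀ i, 4 ≤ i → hilbertFunction (Ann f) i = 0
  hilbert_sq_four : hilbertFunction (Ann f ^ 2) 4 = Nat.card σ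
  hilbert_sq_five : hilbertFunction (Ann f ^ 2) 5 = 0

/-- The index set of the variables `a_i, b_i, c_i` (`i` modulo `m`), `d`, `e`. -/
abbrev Var (m : ℕ) : Type := (Fin 3 × ZMod m) ⊕ Fin 2

theorem card_Var (m : ℕ) [NeZero m] : Nat.card (Var m) = 3 * m + 2 := by
  simp [Var]

variable (k) {m : ℕ}

/-- The variable `a_i`. -/
def a (i : ZMod m) : MvPolynomial (Var m) k := X (Sum.inl (0, i))
/-- The variable `b_i`. -/
def b (i : ZMod m) : MvPolynomial (Var m) k := X (Sum.inl (1, i))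
/-- The variable `c_i`. -/
def c (i : ZMod m) : MvPolynomial (Var m) k := X (Sum.inl (2, i))
/-- The variable `d`. -/
def d : MvPolynomial (Var m) k := X (Sum.inr 0)
/-- The variable `e`. -/
def e : MvPolynomial (Var m) k := X (Sum.inr 1)

variable (m)

/-- The cubic polynomial `F` in the variables `a_i, b_i, c_i`. -/
def cubicF [NeZero m] : MvPolynomial (Var m) k :=
  ∑ i : ZMod m, (a k i * b k i * c k i + a k i * a k (i + 1) ^ 2
    + b k i * b k (i + 1) ^ 2 + c k i * c k (i + 1) ^ 2)

/-- The cubic polynomial `F''`. -/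
def cubicF'' [NeZero m] : MvPolynomial (Var m) k :=
  cubicF k m + ∑ i : ZMod m, (a k i * b k (i + 1) * d k + b k i * c k (i + 1) * e k)

end

end Apolarity

/-
The functionals `s ↦ f (∂ s / ∂ x)` vanish on `I ^ 2`, and they are dual to the "stars", the
quartics `y * T` where `T` is a term of the cubic containing a letter different from `y` and
occurring with `y` in no term. This gives `n` as a lower bound of `H(S/I^2)_4`. Conversely, every
quartic is a combination of stars modulo `I ^ 2`: if neither `x y` nor `y z` divides a term, then
`x y z w = (y z) (x w)` can be rewritten by replacing `z w` or `x w` with any product having the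
same complement in the cubic, and iterating this clears everything but the stars. These moves
only involve letters whose indices are close to each other, so that they can be found over `ℤ`
instead of `ℤ/m`, in a finite window. In degree 5, all stars of `y` are congruent modulo `I ^ 2`,
and for any letter `x` one of them is `y p q r` with `p` occurring in no term with `x` or `y`, so
that `x y p q r = (x p) (y q r)` lies in `I ^ 2`.
-/

namespace Apolarity

open MvPolynomial

section Apolar

variable {σ k : Type*} [Field k] {f : DividedPower σ k} {s : MvPolynomial σ k} {n r : ℕ}

theorem mem_Ann_iff : s ∈ Ann f ↔ ∀ t, f.1 (s * t) = 0 := by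
  rw [mem_Ann, Subtype.ext_iff, LinearMap.ext_iff]
  rfl

theorem apply_pderiv_eq_zero (i : σ) (hs : s ∈ Ann f ^ 2) : f.1 (pderiv i s) = 0 := by
  rw [pow_two] at hs
  refine Submodule.mul_induction_on hs (fun p hp q hq => ?_) fun p q hp hq => ?_
  · rw [Derivation.leibniz, smul_eq_mul, smul_eq_mul, map_add, mem_Ann_iff.1 hp,
      mem_Ann_iff.1 hq, add_zero]
  · rw [map_add, map_add, hp, hq, add_zero]

namespace IsHomogeneousOfDegree

theorem apply_eq_zero (hf : IsHomogeneousOfDegree f r) (hs : s.IsHomogeneous n) (hn : n ≠ r) :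
    f.1 s = 0 := by
  induction hf using Submodule.span_induction with
  | mem g hg =>
    obtain ⟨u, hu, rfl⟩ := hg
    exact hs.coeff_eq_zero (by omega)
  | zero => rfl
  | add g g' _ _ hg hg' => simp [hg, hg']
  | smul c g _ hg => simp [hg]

theorem mem_Ann_of_apply_mul_monomial (hf : IsHomogeneousOfDegree f r) (hs : s.IsHomogeneous n)
    (h : ∀ u : σ →₀ ℕ, n + u.degree = r → f.1 (s * monomial u 1) = 0) : s ∈ Ann f := by
  refine mem_Ann_iff.2 fun t => ?_
  induction t using MvPolynomial.induction_on' with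
  | monomial u c =>
    rw [← mul_one c, ← smul_eq_mul c, ← smul_monomial, mul_smul_comm, map_smul]
    by_cases hu : n + u.degree = r
    · rw [h u hu, smul_zero]
    · rw [hf.apply_eq_zero (hs.mul (isHomogeneous_monomial 1 rfl)) hu, smul_zero]
  | add p q hp hq => rw [mul_add, map_add, hp, hq, add_zero]

theorem mem_Ann_of_lt (hf : IsHomogeneousOfDegree f r) (hs : s.IsHomogeneous n) (hn : r < n) :
    s ∈ Ann f :=
  hf.mem_Ann_of_apply_mul_monomial hs fun _ _ => by omega

theorem mem_Ann_of_apply_eq_zero (hf : IsHomogeneousOfDegree f r) (hs : s.IsHomogeneous r)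
    (h : f.1 s = 0) : s ∈ Ann f := by
  refine hf.mem_Ann_of_apply_mul_monomial hs fun u hu => ?_
  obtain rfl := (Finsupp.degree_eq_zero_iff u).1 (by omega)
  simpa using h

theorem mem_Ann_of_apply_mul_X (hf : IsHomogeneousOfDegree f (n + 1)) (hs : s.IsHomogeneous n)
    (h : ∀ i, f.1 (s * X i) = 0) : s ∈ Ann f := by
  refine hf.mem_Ann_of_apply_mul_monomial hs fun u hu => ?_
  obtain ⟨i, rfl⟩ : u ∈ Set.range (fun i : σ => Finsupp.single i 1) := by
    rw [Finsupp.range_single_one]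
    exact (by omega : u.degree = 1)
  exact h i

end IsHomogeneousOfDegree

end Apolar

section HilbertFunction

variable {σ k : Type*} [Field k] {J : Ideal (MvPolynomial σ k)} {n : ℕ}

theorem hilbertFunction_eq_card_of_dual {ι : Type*} [Finite ι] [DecidableEq ι]
    (w : ι → MvPolynomial σ k) (ψ : ι → Module.Dual k (MvPolynomial σ k))
    (hw : ∀ j, (w j).IsHomogeneous n) (hψ : ∀ j, ∀ s ∈ J, ψ j s = 0)
    (hd : ∀ i j, ψ i (w j) = if i = j then 1 else 0)
    (hs : homogeneousSubmodule σ k n ≤ J.restrictScalars k ⊔ Submodule.span k (Set.range w)) :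
    hilbertFunction J n = Nat.card ι := by
  have := Fintype.ofFinite ι
  set q := (Ideal.Quotient.mkₐ k J).toLinearMap with hq
  have hq0 : ∀ s, q s = 0 ↔ s ∈ J := fun s => Ideal.Quotient.eq_zero_iff_mem
  have map_eq : (homogeneousSubmodule σ k n).map q = Submodule.span k (Set.range (q ∘ w)) := by
    apply le_antisymm
    · refine (Submodule.map_mono hs).trans ?_
      rw [Submodule.map_sup, Submodule.map_span, ← Set.range_comp]
      refine sup_le ?_ le_rfl
      rintro _ ⟨s, hs, rfl⟩
      rw [(hq0 s).2 hs]
      exact zero_mem _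
    · rw [Submodule.span_le]
      rintro _ ⟨j, rfl⟩
      exact ⟨w j, hw j, rfl⟩
  have hli : LinearIndependent k (q ∘ w) := by
    rw [Fintype.linearIndependent_iff]
    intro g hg i
    have mem_J : ∑ j, g j • w j ∈ J := by
      rw [← hq0, map_sum]
      simpa using hg
    simpa [map_sum, hd] using hψ i _ mem_J
  rw [hilbertFunction, ← hq, map_eq, finrank_span_eq_card hli, Nat.card_eq_fintype_card]

theorem hilbertFunction_eq_zero (h : homogeneousSubmodule σ k n ≤ J.restrictScalars k) :
    hilbertFunction J n = 0 := by
  rw [hilbertFunction_eq_card_of_dual (ι := Empty) Empty.elim Empty.elim (by simp) (by simp)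
    (by simp) (h.trans le_sup_left)]
  simp

variable {τ : Type*} {v : τ → σ} {W : Submodule k (MvPolynomial σ k)}

theorem homogeneousSubmodule_zero_le (h : 1 ∈ W) : homogeneousSubmodule σ k 0 ≤ W := by
  rwa [homogeneousSubmodule_zero, Submodule.one_le]

theorem homogeneousSubmodule_succ_le (hv : v.Surjective)
    (h : ∀ x, homogeneousSubmodule σ k n ≤ W.comap (LinearMap.mulLeft k (X (v x)))) :
    homogeneousSubmodule σ k (n + 1) ≤ W := by
  rw [← homogeneousSubmodule_one_pow, pow_succ', homogeneousSubmodule_one_pow,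
    homogeneousSubmodule_one_eq_span_X, Submodule.mul_le]
  intro p hp q hq
  induction hp using Submodule.span_induction with
  | mem _ hp =>
    obtain ⟨i, rfl⟩ := hp
    obtain ⟨x, rfl⟩ := hv i
    exact h x hq
  | zero => simp
  | add p p' _ _ hp hp' => simpa only [add_mul] using add_mem hp hp'
  | smul c p _ hp => simpa only [smul_mul_assoc] using Submodule.smul_mem W c hp

theorem homogeneousSubmodule_one_le (hv : v.Surjective) (h : ∀ x, X (v x) ∈ W) :
    homogeneousSubmodule σ k 1 ≤ W :=
  homogeneousSubmodule_succ_le hv fun x => homogeneousSubmodule_zero_le (by simpa using h x)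

theorem homogeneousSubmodule_two_le (hv : v.Surjective) (h : ∀ x y, X (v x) * X (v y) ∈ W) :
    homogeneousSubmodule σ k 2 ≤ W :=
  homogeneousSubmodule_succ_le hv fun x => homogeneousSubmodule_one_le hv (h x)

theorem homogeneousSubmodule_four_le (hv : v.Surjective)
    (h : ∀ x y z w, X (v x) * X (v y) * (X (v z) * X (v w)) ∈ W) :
    homogeneousSubmodule σ k 4 ≤ W :=
  homogeneousSubmodule_succ_le hv fun x => homogeneousSubmodule_succ_le hv fun y =>
    homogeneousSubmodule_two_le hv fun z w => by simpa [mul_assoc] using h x y z w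

end HilbertFunction

section Quartics

variable {σ τ : Type*} (k : Type*) [Field k] (v : τ ≃ σ)

/-- The product of the four variables indexed by `x`, `y`, `z` and `w`. -/
noncomputable def quad (x y z w : τ) : MvPolynomial σ k :=
  X (v x) * X (v y) * (X (v z) * X (v w))

theorem quad_swap_left (x y z w : τ) : quad k v x y z w = quad k v y x z w := by
  simp only [quad]; ring

theorem quad_swap_right (x y z w : τ) : quad k v x y z w = quad k v x y w z := by
  simp only [quad]; ring

theorem quad_swap_mid (x y z w : τ) : quad k v x y z w = quad k v x z y w := by
  simp only [quad]; ring

theorem quad_isHomogeneous (x y z w : τ) : (quad k v x y z w).IsHomogeneous 4 :=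
  ((isHomogeneous_X _ _).mul (isHomogeneous_X _ _)).mul
    ((isHomogeneous_X _ _).mul (isHomogeneous_X _ _))

/-- The quartics `y * T`, where `T = x z w` is a term of the cubic and the letter `x ≠ y` occurs
with `y` in no term. -/
def stars (third : τ → τ → Option τ) (y : τ) : Set (MvPolynomial σ k) :=
  {s | ∃ x z w, third y x = none ∧ x ≠ y ∧ third z w = some x ∧ s = quad k v y x z w}

variable {k}

/-- The quartics that are, modulo the square of the annihilator, linear combinations of stars. -/
noncomputable def reach (third : τ → τ → Option τ) (f : DividedPower σ k) :
    Submodule k (MvPolynomial σ k) :=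
  (Ann f ^ 2).restrictScalars k ⊔ Submodule.span k (⋃ y, stars k v third y)

/-- All products `x y * q` such that the complement of the quadric `q` in the cubic is `p` lie in
the square of the annihilator. -/
def Vanishes (third : τ → τ → Option τ) (f : DividedPower σ k) (x y p : τ) : Prop :=
  ∀ z w, third z w = some p → quad k v x y z w ∈ Ann f ^ 2

variable {v} {third : τ → τ → Option τ} {f : DividedPower σ k} {s t : MvPolynomial σ k} {x y p : τ}

theorem mem_reach_of_sub_mem (h : s - t ∈ Ann f ^ 2) (ht : t ∈ reach v third f) :
    s ∈ reach v third f :=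
  sub_add_cancel s t ▸ add_mem (Submodule.mem_sup_left h) ht

theorem Vanishes.symm (h : Vanishes v third f x y p) : Vanishes v third f y x p :=
  fun z w hzw => quad_swap_left k v x y z w ▸ h z w hzw

variable (v third f) [DecidableEq τ]

/-- The functional `f` is dual to a cubic that is a sum of distinct monomials, in the variables
indexed by `τ` via `v`, in which two letters `x` and `y` occur together in at most one term; the
third letter of that term, if there is one, is `third x y`. -/
structure IsDualCubic : Prop where
  homogeneous : IsHomogeneousOfDegree f 3
  apply_mul (x y z : τ) :
    f.1 (X (v x) * X (v y) * X (v z)) = if third x y = some z then 1 else 0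

end Quartics

namespace IsDualCubic

variable {σ τ k : Type*} [Field k] [DecidableEq τ] {v : τ ≃ σ} {third : τ → τ → Option τ}
  {f : DividedPower σ k} {x y z w p q : τ} (hf : IsDualCubic v third f)

include hf

theorem apply_mul_eq_one_iff : f.1 (X (v x) * X (v y) * X (v z)) = 1 ↔ third x y = some z := by
  simp [hf.apply_mul]

theorem third_comm (x y : τ) : third x y = third y x :=
  Option.ext fun z => by
    rw [← hf.apply_mul_eq_one_iff, ← hf.apply_mul_eq_one_iff, mul_comm (X (v x))]

theorem third_rotate (h : third x y = some z) : third y z = some x := by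
  rw [← hf.apply_mul_eq_one_iff] at h ⊢
  rw [← h, ← mul_rotate]

theorem third_swap (h : third x y = some z) : third x z = some y :=
  hf.third_rotate ((hf.third_comm y x).trans h)

theorem mul_mem_Ann (h : third x y = none) : X (v x) * X (v y) ∈ Ann f :=
  hf.homogeneous.mem_Ann_of_apply_mul_X ((isHomogeneous_X _ _).mul (isHomogeneous_X _ _))
    (v.surjective.forall.2 fun z => by simp [hf.apply_mul, h])

theorem sub_mem_Ann (h : third x y = third z w) :
    X (v x) * X (v y) - X (v z) * X (v w) ∈ Ann f :=
  hf.homogeneous.mem_Ann_of_apply_mul_X (((isHomogeneous_X _ _).mul (isHomogeneous_X _ _)).sub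
    ((isHomogeneous_X _ _).mul (isHomogeneous_X _ _)))
    (v.surjective.forall.2 fun u => by simp [sub_mul, hf.apply_mul, h])

theorem triple_mem_Ann (h : third x y ≠ some z) : X (v x) * X (v y) * X (v z) ∈ Ann f :=
  hf.homogeneous.mem_Ann_of_apply_eq_zero
    (((isHomogeneous_X _ _).mul (isHomogeneous_X _ _)).mul (isHomogeneous_X _ _))
    (by rw [hf.apply_mul, if_neg h])

theorem quad_mem (hxy : third x y = none) (hzw : third z w = none) :
    quad k v x y z w ∈ Ann f ^ 2 := by
  rw [pow_two]
  exact Ideal.mul_mem_mul (hf.mul_mem_Ann hxy) (hf.mul_mem_Ann hzw)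

theorem quad_sub_mem (hxy : third x y = none) (h : third z w = third p q) :
    quad k v x y z w - quad k v x y p q ∈ Ann f ^ 2 := by
  rw [quad, quad, ← mul_sub, pow_two]
  exact Ideal.mul_mem_mul (hf.mul_mem_Ann hxy) (hf.sub_mem_Ann h)

theorem quad_exchange_mem {x' y' z' w' : τ} (hxy : third x y = third x' y')
    (hzw : third z w = third z' w') :
    quad k v x y z w - (quad k v x y z' w' + quad k v x' y' z w - quad k v x' y' z' w')
      ∈ Ann f ^ 2 := by
  rw [pow_two]
  convert Ideal.mul_mem_mul (hf.sub_mem_Ann hxy) (hf.sub_mem_Ann hzw) using 1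
  simp only [quad]
  ring

theorem quad_mem_reach_of_exchange {x' y' z' w' : τ} (hxy : third x y = third x' y')
    (hzw : third z w = third z' w') (h₁ : quad k v x' y' z w ∈ reach v third f)
    (h₂ : quad k v x y z' w' ∈ reach v third f) (h₃ : quad k v x' y' z' w' ∈ reach v third f) :
    quad k v x y z w ∈ reach v third f :=
  mem_reach_of_sub_mem (hf.quad_exchange_mem hxy hzw) (sub_mem (add_mem h₂ h₁) h₃)

theorem X_mul_quad_mem {r u : τ} (h : third q r = some p) (hu : third u p = none) (hp : p ≠ y) :
    X (v u) * quad k v y p q r ∈ Ann f ^ 2 := by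
  have hy : third q r ≠ some y := by simpa [h] using hp
  rw [pow_two]
  convert Ideal.mul_mem_mul (hf.mul_mem_Ann hu) (hf.triple_mem_Ann hy) using 1
  simp only [quad]
  ring

/-- `x y * z w = y z * x w`, and in the latter the factor `x w` may be replaced by anything with
the same complement. -/
theorem vanishes_of_slide (hxy : third x y = none) (hzw : third z w = some p)
    (hyz : third y z = none) (h : ∀ u ∈ third x w, Vanishes v third f y z u) :
    Vanishes v third f x y p := by
  intro z' w' hp
  have slide : quad k v x y z w = quad k v y z x w := by simp only [quad]; ring
  rw [← sub_add_cancel (quad k v x y z' w') (quad k v x y z w)]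
  refine add_mem (hf.quad_sub_mem hxy (hp.trans hzw.symm)) ?_
  rw [slide]
  cases hxw : third x w with
  | none => exact hf.quad_mem hyz hxw
  | some u => exact h u hxw x w hxw

theorem vanishes_of_third_eq_none (hxy : third x y = none) (hzw : third z w = some p)
    (hyz : third y z = none) (hxw : third x w = none) : Vanishes v third f x y p :=
  hf.vanishes_of_slide hxy hzw hyz (by simp [hxw])

end IsDualCubic

section HilbertFunction

variable {σ τ k : Type*} [Field k] [DecidableEq τ] {v : τ ≃ σ} {third : τ → τ → Option τ}
  {f : DividedPower σ k} (hf : IsDualCubic v third f) {s : MvPolynomial σ k} {x y z w : τ}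

namespace IsDualCubic

include hf

theorem exists_cubic_dual_one [Nonempty τ] (hpair : ∀ z, ∃ x y, third x y = some z) :
    ∃ T : MvPolynomial σ k, T.IsHomogeneous 3 ∧ f.1 T = 1 := by
  obtain ⟨z⟩ := ‹Nonempty τ›
  obtain ⟨x, y, h⟩ := hpair z
  exact ⟨X (v x) * X (v y) * X (v z),
    ((isHomogeneous_X _ _).mul (isHomogeneous_X _ _)).mul (isHomogeneous_X _ _),
    hf.apply_mul_eq_one_iff.2 h⟩

theorem hilbertFunction_zero [Nonempty τ] (hpair : ∀ z, ∃ x y, third x y = some z) :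
    hilbertFunction (Ann f) 0 = 1 := by
  obtain ⟨T, -, hT⟩ := hf.exists_cubic_dual_one hpair
  rw [hilbertFunction_eq_card_of_dual (ι := Unit) (fun _ => 1)
    (fun _ => f.1 ∘ₗ LinearMap.mulRight k T) (fun _ => isHomogeneous_one _ _)
    (fun _ s hs => mem_Ann_iff.1 hs T) (fun _ _ => by simp [hT])
    (homogeneousSubmodule_zero_le (Submodule.mem_sup_right (Submodule.subset_span ⟨(), rfl⟩)))]
  simp

theorem hilbertFunction_one [Finite τ] (hpair : ∀ z, ∃ x y, third x y = some z) :
    hilbertFunction (Ann f) 1 = Nat.card σ := by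
  choose x y hxy using hpair
  rw [← Nat.card_congr v]
  refine hilbertFunction_eq_card_of_dual (fun z => X (v z))
    (fun z => f.1 ∘ₗ LinearMap.mulLeft k (X (v (x z)) * X (v (y z))))
    (fun _ => isHomogeneous_X _ _) (fun _ s hs => ?_) (fun z z' => ?_)
    (homogeneousSubmodule_one_le v.surjective fun z =>
      Submodule.mem_sup_right (Submodule.subset_span ⟨z, rfl⟩))
  · rw [LinearMap.comp_apply, LinearMap.mulLeft_apply, mul_comm]
    exact mem_Ann_iff.1 hs _
  · rw [LinearMap.comp_apply, LinearMap.mulLeft_apply, hf.apply_mul, hxy]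
    simp

theorem hilbertFunction_two [Finite τ] (hpair : ∀ z, ∃ x y, third x y = some z) :
    hilbertFunction (Ann f) 2 = Nat.card σ := by
  choose x y hxy using hpair
  rw [← Nat.card_congr v]
  refine hilbertFunction_eq_card_of_dual (fun z => X (v (x z)) * X (v (y z)))
    (fun z => f.1 ∘ₗ LinearMap.mulRight k (X (v z)))
    (fun _ => (isHomogeneous_X _ _).mul (isHomogeneous_X _ _))
    (fun z s hs => mem_Ann_iff.1 hs _) (fun z z' => ?_)
    (homogeneousSubmodule_two_le v.surjective fun u w => ?_)
  · simp [hf.apply_mul, hxy, eq_comm]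
  · cases h : third u w with
    | none => exact Submodule.mem_sup_left (hf.mul_mem_Ann h)
    | some z =>
      rw [← sub_add_cancel (X (v u) * X (v w)) (X (v (x z)) * X (v (y z)))]
      exact add_mem (Submodule.mem_sup_left (hf.sub_mem_Ann (h.trans (hxy z).symm)))
        (Submodule.mem_sup_right (Submodule.subset_span ⟨z, rfl⟩))

theorem hilbertFunction_three [Nonempty τ] (hpair : ∀ z, ∃ x y, third x y = some z) :
    hilbertFunction (Ann f) 3 = 1 := by
  obtain ⟨T, hT, hfT⟩ := hf.exists_cubic_dual_one hpair
  rw [hilbertFunction_eq_card_of_dual (ι := Unit) (fun _ => T) (fun _ => f.1) (fun _ => hT)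
    (fun _ s hs => by simpa using mem_Ann_iff.1 hs 1) (fun _ _ => by simp [hfT]) fun s hs => ?_]
  · simp
  · rw [← sub_add_cancel s (f.1 s • T)]
    refine add_mem (Submodule.mem_sup_left (hf.homogeneous.mem_Ann_of_apply_eq_zero ?_ ?_))
      (Submodule.mem_sup_right (Submodule.smul_mem _ _ (Submodule.subset_span ⟨(), rfl⟩)))
    · exact IsHomogeneous.sub hs (Submodule.smul_mem (homogeneousSubmodule σ k 3) _ hT)
    · simp [hfT]

theorem apply_pderiv_of_mem_stars (hs : s ∈ stars k v third y) (x : τ) :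
    f.1 (pderiv (v x) s) = if x = y then 1 else 0 := by
  obtain ⟨p, q, r, hyp, hpy, hqr, rfl⟩ := hs
  have hrp : third r p = some q := hf.third_rotate hqr
  have hpq : third p q = some r := hf.third_rotate hrp
  have hpy' : third p y = none := (hf.third_comm p y).trans hyp
  have hqy : q ≠ y := by rintro rfl; simp [hpq] at hpy'
  have hry : r ≠ y := by rintro rfl; simp [hrp] at hyp
  have apply_eq_zero {t u z : τ} (h : third t u = some z) (hz : z ≠ y) :
      f.1 (X (v t) * X (v u) * X (v y)) = 0 := by
    simp [hf.apply_mul, h, hz]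
  have pderiv_var (p : τ) :
      pderiv (v x) (X (v p) : MvPolynomial σ k) = (if x = p then 1 else 0 : k) • 1 := by
    classical
    simp [pderiv_X, Pi.single_apply, eq_comm]
  have expand : pderiv (v x) (quad k v y p q r) =
      (if x = y then 1 else 0 : k) • (X (v q) * X (v r) * X (v p))
        + (if x = p then 1 else 0 : k) • (X (v q) * X (v r) * X (v y))
        + (if x = q then 1 else 0 : k) • (X (v r) * X (v p) * X (v y))
        + (if x = r then 1 else 0 : k) • (X (v p) * X (v q) * X (v y)) := by
    simp only [quad, Derivation.leibniz, pderiv_var, smul_eq_C_mul, smul_eq_mul]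
    ring
  simp only [expand, map_add, map_smul, apply_eq_zero hqr hpy, apply_eq_zero hrp hqy,
    apply_eq_zero hpq hry, hf.apply_mul, hqr]
  simp

theorem hilbertFunction_sq_four [Finite τ] (hstar : ∀ y, (stars k v third y).Nonempty)
    (hcong : ∀ y, ∀ s ∈ stars k v third y, ∀ s' ∈ stars k v third y, s - s' ∈ Ann f ^ 2)
    (hquad : ∀ x y z w, quad k v x y z w ∈ reach v third f) :
    hilbertFunction (Ann f ^ 2) 4 = Nat.card σ := by
  choose ε hε using hstar
  rw [← Nat.card_congr v]
  refine hilbertFunction_eq_card_of_dual ε (fun x => f.1 ∘ₗ (pderiv (v x)).toLinearMap)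
    (fun y => ?_) (fun x s hs => apply_pderiv_eq_zero (v x) hs)
    (fun x y => hf.apply_pderiv_of_mem_stars (hε y) x)
    ((homogeneousSubmodule_four_le v.surjective hquad).trans (sup_le le_sup_left ?_))
  · obtain ⟨x, z, w, -, -, -, h⟩ := hε y
    exact h ▸ quad_isHomogeneous k v y x z w
  · refine Submodule.span_le.2 (Set.iUnion_subset fun y s hs => ?_)
    rw [← sub_add_cancel s (ε y)]
    exact add_mem (Submodule.mem_sup_left (hcong y s hs _ (hε y)))
      (Submodule.mem_sup_right (Submodule.subset_span ⟨y, rfl⟩))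

omit hf [DecidableEq τ] in
theorem hilbertFunction_sq_five
    (hcong : ∀ y, ∀ s ∈ stars k v third y, ∀ s' ∈ stars k v third y, s - s' ∈ Ann f ^ 2)
    (hquad : ∀ x y z w, quad k v x y z w ∈ reach v third f)
    (hmul : ∀ x y, ∃ s ∈ stars k v third y, X (v x) * s ∈ Ann f ^ 2) :
    hilbertFunction (Ann f ^ 2) 5 = 0 := by
  refine hilbertFunction_eq_zero (homogeneousSubmodule_succ_le v.surjective fun x =>
    (homogeneousSubmodule_four_le v.surjective hquad).trans (sup_le ?_ ?_))
  · exact fun s hs => Ideal.mul_mem_left _ _ hs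
  · refine Submodule.span_le.2 (Set.iUnion_subset fun y s hs => ?_)
    obtain ⟨s', hs', hmem⟩ := hmul x y
    have : X (v x) * (s - s') + X (v x) * s' ∈ Ann f ^ 2 :=
      add_mem (Ideal.mul_mem_left _ _ (hcong y s hs s' hs')) hmem
    simpa [← mul_add] using this

theorem smallTangentSpaceCondition [Finite σ] [Nonempty τ]
    (hpair : ∀ z, ∃ x y, third x y = some z)
    (hcong : ∀ y, ∀ s ∈ stars k v third y, ∀ s' ∈ stars k v third y, s - s' ∈ Ann f ^ 2)
    (hquad : ∀ x y z w, quad k v x y z w ∈ reach v third f)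
    (hmul : ∀ x y, ∃ s ∈ stars k v third y, X (v x) * s ∈ Ann f ^ 2) :
    SmallTangentSpaceCondition f := by
  have : Finite τ := .of_equiv σ v.symm
  exact
    { homogeneous := hf.homogeneous
      hilbert_zero := hf.hilbertFunction_zero hpair
      hilbert_one := hf.hilbertFunction_one hpair
      hilbert_two := hf.hilbertFunction_two hpair
      hilbert_three := hf.hilbertFunction_three hpair
      hilbert_ge_four := fun _ hi =>
        hilbertFunction_eq_zero fun _ hs => hf.homogeneous.mem_Ann_of_lt hs hi
      hilbert_sq_four :=
        hf.hilbertFunction_sq_four (fun y => (hmul y y).imp fun _ h => h.1) hcong hquad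
      hilbert_sq_five := hilbertFunction_sq_five hcong hquad hmul }

end IsDualCubic

end HilbertFunction

theorem triple_eq_triple_iff {α : Type*} {x y z p q r : α} :
    ({x, y, z} : Multiset α) = {p, q, r} ↔
      x = p ∧ y = q ∧ z = r ∨ x = p ∧ y = r ∧ z = q ∨ x = q ∧ y = p ∧ z = r ∨
      x = q ∧ y = r ∧ z = p ∨ x = r ∧ y = p ∧ z = q ∨ x = r ∧ y = q ∧ z = p := by
  classical
  simp only [Multiset.ext, Multiset.insert_eq_cons, Multiset.count_cons, Multiset.count_singleton]
  constructor
  · intro h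
    have := h x; have := h y; have := h z
    have := h p; have := h q; have := h r
    clear h
    grind
  · rintro (⟨rfl, rfl, rfl⟩ | ⟨rfl, rfl, rfl⟩ | ⟨rfl, rfl, rfl⟩ | ⟨rfl, rfl, rfl⟩ |
      ⟨rfl, rfl, rfl⟩ | ⟨rfl, rfl, rfl⟩) <;> intro s <;> omega

/-- The variables of the cubic `F''`, with indices in `R`: for `R = ZMod m` they are the variables
of the polynomial ring, and for `R = ℤ` they are used to compute with nearby indices. -/
inductive Letter (R : Type*) where
  | a (i : R) | b (i : R) | c (i : R) | d | e
  deriving DecidableEq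

namespace Letter

/-- The equivalence of the letters with indices modulo `m` and the variables. -/
def equivVar (m : ℕ) : Letter (ZMod m) ≃ Var m where
  toFun
    | .a i => Sum.inl (0, i)
    | .b i => Sum.inl (1, i)
    | .c i => Sum.inl (2, i)
    | .d => Sum.inr 0
    | .e => Sum.inr 1
  invFun
    | Sum.inl (0, i) => .a i
    | Sum.inl (1, i) => .b i
    | Sum.inl (2, i) => .c i
    | Sum.inr 0 => .d
    | Sum.inr 1 => .e
  left_inv x := by cases x <;> rfl
  right_inv x := by rcases x with ⟨r, i⟩ | r <;> fin_cases r <;> rfl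

section Ring

variable {R : Type*} [Ring R] {i j : R} {r s : Fin 6}

/-- The six terms of the `i`-th summand of the cubic `F''`. -/
def term (i : R) : Fin 6 → Multiset (Letter R)
  | 0 => {a i, b i, c i}
  | 1 => {a i, a (i + 1), a (i + 1)}
  | 2 => {b i, b (i + 1), b (i + 1)}
  | 3 => {c i, c (i + 1), c (i + 1)}
  | 4 => {a i, b (i + 1), d}
  | 5 => {b i, c (i + 1), e}

theorem term_inj : term i r = term j s ↔ i = j ∧ r = s := by
  refine ⟨fun h => ?_, by rintro ⟨rfl, rfl⟩; rfl⟩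
  fin_cases r <;> fin_cases s <;>
    simp [term, triple_eq_triple_iff, -Multiset.insert_eq_cons] at h ⊢ <;> tauto

variable [DecidableEq R] {x y z : Letter R}

/-- The letter `z` such that `x y z` is a term of the cubic `F''`, if there is one. -/
def third : Letter R → Letter R → Option (Letter R)
  | a i, a j => if j = i + 1 then some (a j) else if i = j + 1 then some (a i)
      else if i = j then some (a (i - 1)) else none
  | b i, b j => if j = i + 1 then some (b j) else if i = j + 1 then some (b i)
      else if i = j then some (b (i - 1)) else none
  | c i, c j => if j = i + 1 then some (c j) else if i = j + 1 then some (c i)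
      else if i = j then some (c (i - 1)) else none
  | a i, b j | b j, a i => if i = j then some (c i) else if j = i + 1 then some d else none
  | a i, c j | c j, a i => if i = j then some (b i) else none
  | b i, c j | c j, b i => if i = j then some (a i) else if j = i + 1 then some e else none
  | a i, d | d, a i => some (b (i + 1))
  | b i, d | d, b i => some (a (i - 1))
  | b i, e | e, b i => some (c (i + 1))
  | c i, e | e, c i => some (b (i - 1))
  | a _, e | e, a _ | c _, d | d, c _ | d, d | d, e | e, d | e, e => none

theorem third_eq_of_eq_term (h1 : (1 : R) ≠ 0) (h2 : (2 : R) ≠ 0) (h : {x, y, z} = term i r) :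
    third x y = some z := by
  have h2' : i ≠ i + 1 + 1 := fun h => h2 (by rwa [add_assoc, one_add_one_eq_two, left_eq_add] at h)
  fin_cases r <;> simp only [term, triple_eq_triple_iff] at h <;>
    rcases h with ⟨rfl, rfl, rfl⟩ | ⟨rfl, rfl, rfl⟩ | ⟨rfl, rfl, rfl⟩ | ⟨rfl, rfl, rfl⟩ |
      ⟨rfl, rfl, rfl⟩ | ⟨rfl, rfl, rfl⟩ <;> simp [third, h1, h2']

theorem exists_eq_term_of_third_eq (h : third x y = some z) : ∃ i r, {x, y, z} = term i r := by
  rcases x with i | i | i | _ | _ <;> rcases y with j | j | j | _ | _ <;>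
    simp only [third] at h <;> (try split_ifs at h) <;>
    simp only [Option.some.injEq, reduceCtorEq] at h <;> subst h <;>
    simp only [Fin.exists_fin_succ, IsEmpty.exists_iff, or_false] <;>
    first
    | (use i; simp_all [term, triple_eq_triple_iff, -Multiset.insert_eq_cons]; done)
    | (use j; simp_all [term, triple_eq_triple_iff, -Multiset.insert_eq_cons]; done)
    | (use i - 1; simp_all [term, triple_eq_triple_iff, -Multiset.insert_eq_cons]; done)
    | (use j - 1; simp_all [term, triple_eq_triple_iff, -Multiset.insert_eq_cons])

end Ring

section Cubic

variable {k : Type*} [Field k] {m : ℕ}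

/-- The exponent of the monomial with the given letters. -/
noncomputable def exponent (t : Multiset (Letter (ZMod m))) : Var m →₀ ℕ :=
  Multiset.toFinsupp (t.map (equivVar m))

theorem exponent_injective : Function.Injective (exponent (m := m)) :=
  Multiset.toFinsupp.injective.comp (Multiset.map_injective (equivVar m).injective)

theorem degree_exponent_term (i : ZMod m) (r : Fin 6) : (exponent (term i r)).degree = 3 := by
  fin_cases r <;> simp [exponent, term, Multiset.insert_eq_cons, ← Multiset.singleton_add]

theorem X_mul_X_mul_X (x y z : Letter (ZMod m)) :
    (X (equivVar m x) * X (equivVar m y) * X (equivVar m z) : MvPolynomial (Var m) k) =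
      monomial (exponent {x, y, z}) 1 := by
  simp [X, monomial_mul, exponent, Multiset.insert_eq_cons, ← Multiset.singleton_add, add_assoc]

variable [NeZero m]

theorem cubicF''_eq_sum : cubicF'' k m = ∑ i, ∑ r, monomial (exponent (term i r)) 1 := by
  rw [cubicF'', cubicF, ← Finset.sum_add_distrib]
  refine Finset.sum_congr rfl fun i _ => ?_
  simp only [Fin.sum_univ_six, term, ← X_mul_X_mul_X, equivVar, Equiv.coe_fn_mk, Apolarity.a,
    Apolarity.b, Apolarity.c, Apolarity.d, Apolarity.e]
  ring

theorem dualElement_cubicF'' :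
    dualElement (cubicF'' k m) = ∑ i, ∑ r, dualMonomial (exponent (term i r)) := by
  have dualElement_monomial (s : Var m →₀ ℕ) :
      dualElement (monomial s (1 : k)) = dualMonomial s := by
    simpa [dualElement] using (basisMonomials (Var m) k).constr_basis k dualMonomial s
  simp only [cubicF''_eq_sum, map_sum, dualElement_monomial]

theorem isDualCubic_cubicF'' (h1 : (1 : ZMod m) ≠ 0) (h2 : (2 : ZMod m) ≠ 0) :
    IsDualCubic (equivVar m) third (dualElement (cubicF'' k m)) where
  homogeneous := by
    rw [dualElement_cubicF'']
    exact Submodule.sum_mem _ fun i _ => Submodule.sum_mem _ fun r _ =>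
      Submodule.subset_span ⟨_, degree_exponent_term i r, rfl⟩
  apply_mul x y z := by
    classical
    simp only [X_mul_X_mul_X, dualElement_cubicF'', Submodule.coe_sum, LinearMap.sum_apply,
      dualMonomial_monomial, exponent_injective.eq_iff]
    split_ifs with h
    · obtain ⟨i, r, h⟩ := exists_eq_term_of_third_eq h
      simp only [h, term_inj, ite_and]
      simp
    · refine Finset.sum_eq_zero fun i _ => Finset.sum_eq_zero fun r _ => if_neg fun h' => h ?_
      exact third_eq_of_eq_term h1 h2 h'.symm

end Cubic

end Letter

section Connectivity

/-- A step from `x` to `x'`: the two letters occur together in a term, and `y` and `x'` do not. -/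
def Step {τ : Type*} (third : τ → τ → Option τ) (y x x' : τ) : Prop :=
  third y x' = none ∧ third x x' ≠ none

theorem IsDualCubic.star_sub_star_mem {σ τ k : Type*} [Field k] [DecidableEq τ] {v : τ ≃ σ}
    {third : τ → τ → Option τ} {f : DividedPower σ k} (hf : IsDualCubic v third f)
    {x y z w x' z' w' : τ} (hsteps : Relation.ReflTransGen (Step third y) x x')
    (hyx : third y x = none) (hzw : third z w = some x) (hzw' : third z' w' = some x') :
    quad k v y x z w - quad k v y x' z' w' ∈ Ann f ^ 2 := by
  induction hsteps using Relation.ReflTransGen.head_induction_on generalizing z w with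
  | refl => exact hf.quad_sub_mem hyx (hzw.trans hzw'.symm)
  | @head x x'' hstep _ ih =>
    obtain ⟨u, hu⟩ := Option.ne_none_iff_exists'.1 hstep.2
    have h₁ := hf.quad_sub_mem hyx (hzw.trans (hf.third_rotate hu).symm)
    have h₂ := ih hstep.1 (hf.third_swap hu)
    rw [quad_swap_mid k v y x'' x u] at h₂
    rw [← sub_add_sub_cancel]
    exact add_mem h₁ h₂

theorem IsDualCubic.stars_sub_mem {σ τ k : Type*} [Field k] [DecidableEq τ] {v : τ ≃ σ}
    {third : τ → τ → Option τ} {f : DividedPower σ k} (hf : IsDualCubic v third f) {y o : τ}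
    (hpair : ∀ z, ∃ x y, third x y = some z)
    (hconn : ∀ x, x ≠ y → third y x = none → Relation.ReflTransGen (Step third y) x o)
    {s s' : MvPolynomial σ k} (hs : s ∈ stars k v third y) (hs' : s' ∈ stars k v third y) :
    s - s' ∈ Ann f ^ 2 := by
  obtain ⟨x, z, w, hyx, hxy, hzw, rfl⟩ := hs
  obtain ⟨x', z', w', hyx', hxy', hzw', rfl⟩ := hs'
  obtain ⟨p, q, hpq⟩ := hpair o
  rw [← sub_sub_sub_cancel_right]
  exact sub_mem (hf.star_sub_star_mem (hconn x hxy hyx) hyx hzw hpq)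
    (hf.star_sub_star_mem (hconn x' hxy' hyx') hyx' hzw' hpq)

end Connectivity

namespace Letter

variable {m : ℕ}

theorem natCast_ne_zero {n : ℕ} (h0 : 0 < n) (hn : n < m) : (n : ZMod m) ≠ 0 := by
  rw [Ne, ZMod.natCast_eq_zero_iff]
  exact Nat.not_dvd_of_pos_of_lt h0 hn

theorem third_a_b_add_one (hm : 1 < m) (l : ZMod m) : third (a l) (b (l + 1)) = some d := by
  have h1 : (1 : ZMod m) ≠ 0 := mod_cast natCast_ne_zero one_pos hm
  simp [third, h1]

theorem third_b_c_add_one (hm : 1 < m) (l : ZMod m) : third (b l) (c (l + 1)) = some e := by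
  have h1 : (1 : ZMod m) ≠ 0 := mod_cast natCast_ne_zero one_pos hm
  simp [third, h1]

theorem exists_third_eq (hm : 1 < m) (z : Letter (ZMod m)) : ∃ x y, third x y = some z := by
  cases z with
  | a i => exact ⟨b i, c i, by simp [third]⟩
  | b i => exact ⟨a i, c i, by simp [third]⟩
  | c i => exact ⟨a i, b i, by simp [third]⟩
  | d => exact ⟨a 0, b (0 + 1), third_a_b_add_one hm 0⟩
  | e => exact ⟨b 0, c (0 + 1), third_b_c_add_one hm 0⟩

theorem third_b_a_eq_none_iff {i l : ZMod m} :
    third (b i) (a l) = none ↔ l ≠ i ∧ l + 1 ≠ i := by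
  simp only [third]
  grind

theorem reflTransGen_step_b_a_a (hm : 2 < m) {i l : ZMod m}
    (h : third (b i) (a l) = none) :
    Relation.ReflTransGen (Step third (b i)) (a l) (a (i + 1)) := by
  have : NeZero m := ⟨by omega⟩
  have h2 : (2 : ZMod m) ≠ 0 := mod_cast natCast_ne_zero two_pos hm
  rw [third_b_a_eq_none_iff] at h
  have key (n : ℕ) (hn : n + 2 < m) :
      Relation.ReflTransGen (Step third (b i)) (a (i + 1 + n)) (a (i + 1)) := by
    induction n with
    | zero => simp [Relation.ReflTransGen.refl]
    | succ n ih =>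
      have hn1 : (n + 1 : ZMod m) ≠ 0 := mod_cast natCast_ne_zero (by omega) (by omega)
      have hn2 : (n + 2 : ZMod m) ≠ 0 := mod_cast natCast_ne_zero (by omega) (by omega)
      refine .head ⟨third_b_a_eq_none_iff.2 (by grind), ?_⟩ (ih (by omega))
      simp only [third]
      grind
  obtain ⟨n, hn, rfl⟩ : ∃ n < m, i + 1 + (n : ZMod m) = l :=
    ⟨(l - (i + 1)).val, ZMod.val_lt _, by rw [ZMod.natCast_zmod_val]; ring⟩
  refine key n (by_contra fun hnm => ?_)
  have hm0 := ZMod.natCast_self m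
  obtain rfl | rfl : m = n + 1 ∨ m = n + 2 := by omega
  all_goals
    push_cast at hm0
    grind

theorem reflTransGen_step_a {i : ZMod m} {x : Letter (ZMod m)} (hne : x ≠ a i)
    (hx : third (a i) x = none) : Relation.ReflTransGen (Step third (a i)) x e := by
  have via_c (l : ZMod m) : Relation.ReflTransGen (Step third (a i)) (c l) e :=
    .single ⟨rfl, by simp [third]⟩
  cases x with
  | a l =>
    have hc : third (a i) (c l) = none := by simpa [third, eq_comm] using hne
    exact .head ⟨hc, by simp [third]⟩ (via_c l)
  | b l => exact .single ⟨rfl, by simp [third]⟩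
  | c l => exact via_c l
  | d => simp [third] at hx
  | e => exact .refl

theorem reflTransGen_step_c {i : ZMod m} {x : Letter (ZMod m)} (hne : x ≠ c i)
    (hx : third (c i) x = none) : Relation.ReflTransGen (Step third (c i)) x d := by
  have via_a (l : ZMod m) : Relation.ReflTransGen (Step third (c i)) (a l) d :=
    .single ⟨rfl, by simp [third]⟩
  cases x with
  | c l =>
    have ha : third (c i) (a l) = none := by simpa [third] using hne
    exact .head ⟨ha, by simp [third]⟩ (via_a l)
  | b l => exact .single ⟨rfl, by simp [third]⟩
  | a l => exact via_a l
  | e => simp [third] at hx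
  | d => exact .refl

theorem reflTransGen_step_b (hm : 3 < m) {i : ZMod m} {x : Letter (ZMod m)}
    (hne : x ≠ b i) (hx : third (b i) x = none) :
    Relation.ReflTransGen (Step third (b i)) x (a (i + 1)) := by
  have h3 : (3 : ZMod m) ≠ 0 := mod_cast natCast_ne_zero three_pos hm
  have of_a {l : ZMod m} (h : l ≠ i ∧ l + 1 ≠ i) :
      Relation.ReflTransGen (Step third (b i)) (a l) (a (i + 1)) :=
    reflTransGen_step_b_a_a (by omega) (third_b_a_eq_none_iff.2 h)
  have via_a {x : Letter (ZMod m)} {l : ZMod m} (h : l ≠ i ∧ l + 1 ≠ i)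
      (hx : third x (a l) ≠ none) :
      Relation.ReflTransGen (Step third (b i)) x (a (i + 1)) :=
    .head ⟨third_b_a_eq_none_iff.2 h, hx⟩ (of_a h)
  cases x with
  | a l => exact of_a (third_b_a_eq_none_iff.1 hx)
  | b l =>
    refine via_a (l := l) ?_ (by simp [third])
    simp only [third] at hx
    grind
  | c l =>
    have hl : l ≠ i ∧ l ≠ i + 1 := by
      simp only [third] at hx
      grind
    by_cases hli : l + 1 = i
    · refine .head (b := c (l - 1)) ⟨?_, ?_⟩ (via_a (l := l - 1) (by grind) (by simp [third]))
      all_goals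
        simp only [third]
        grind
    · exact via_a ⟨hl.1, hli⟩ (by simp [third])
  | d => simp [third] at hx
  | e => simp [third] at hx

theorem reflTransGen_step_d {x : Letter (ZMod m)} (hne : x ≠ d) (hx : third d x = none) :
    Relation.ReflTransGen (Step third d) x e := by
  cases x with
  | c l => exact .single ⟨rfl, by simp [third]⟩
  | e => exact .refl
  | d => exact absurd rfl hne
  | _ => simp [third] at hx

theorem reflTransGen_step_e {x : Letter (ZMod m)} (hne : x ≠ e) (hx : third e x = none) :
    Relation.ReflTransGen (Step third e) x d := by
  cases x with
  | a l => exact .single ⟨rfl, by simp [third]⟩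
  | d => exact .refl
  | e => exact absurd rfl hne
  | _ => simp [third] at hx

theorem exists_reflTransGen_step (hm : 3 < m) (y : Letter (ZMod m)) :
    ∃ o, ∀ x, x ≠ y → third y x = none → Relation.ReflTransGen (Step third y) x o := by
  cases y with
  | a i => exact ⟨e, fun _ => reflTransGen_step_a⟩
  | b i => exact ⟨a (i + 1), fun _ => reflTransGen_step_b hm⟩
  | c i => exact ⟨d, fun _ => reflTransGen_step_c⟩
  | d => exact ⟨e, fun _ => reflTransGen_step_d⟩
  | e => exact ⟨d, fun _ => reflTransGen_step_e⟩

/-- The index of a letter, and `0` for the letters `d` and `e`. -/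
def index : Letter (ZMod m) → ZMod m
  | a i | b i | c i => i
  | d | e => 0

theorem exists_ne_of_five_lt (hm : 5 < m) (i₁ i₂ i₃ i₄ i₅ : ZMod m) :
    ∃ l, l ≠ i₁ ∧ l ≠ i₂ ∧ l ≠ i₃ ∧ l ≠ i₄ ∧ l ≠ i₅ := by
  have : NeZero m := ⟨by omega⟩
  obtain ⟨l, hl⟩ := Finset.exists_mem_notMem_of_card_lt_card
    (s := {i₁, i₂, i₃, i₄, i₅}) (t := Finset.univ)
    (by rw [Finset.card_univ, ZMod.card]; exact Finset.card_le_five.trans_lt hm)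
  exact ⟨l, by simpa using hl⟩

theorem exists_third_eq_none_of_pair (hm : 5 < m) (x y : Letter (ZMod m)) :
    ∃ p, p ≠ y ∧ third x p = none ∧ third y p = none := by
  obtain ⟨l, hl⟩ := exists_ne_of_five_lt hm (index x - 1) (index x) (index x + 1) (index y - 1)
    (index y)
  obtain ⟨l', hl'⟩ := exists_ne_of_five_lt hm (index y - 1) (index y) (index y + 1) (index x - 1)
    (index x)
  rcases x with i | i | i | _ | _ <;> rcases y with j | j | j | _ | _ <;>
    simp only [index] at hl hl' <;>
    first
    | (use e; simp only [third, ne_eq, reduceCtorEq, not_false_eq_true, and_self]; done)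
    | (use d; simp only [third, ne_eq, reduceCtorEq, not_false_eq_true, and_self]; done)
    | (use a l; simp only [third, ne_eq, a.injEq, reduceCtorEq]; grind)
    | (use a l'; simp only [third, ne_eq, a.injEq, reduceCtorEq]; grind)
    | (use c l; simp only [third, ne_eq, reduceCtorEq]; grind)
    | (use c l'; simp only [third, ne_eq, reduceCtorEq]; grind)

theorem exists_third_a_b_eq_none (hm : 5 < m) {x y : Letter (ZMod m)} (hx : x ≠ d) (hy : y ≠ d)
    (hxy : x ≠ e ∨ y ≠ e) :
    ∃ l, third x (a l) = none ∧ third y (b (l + 1)) = none ∨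
      third y (a l) = none ∧ third x (b (l + 1)) = none := by
  obtain ⟨l, hl⟩ := exists_ne_of_five_lt hm (index x - 2) (index x - 1) (index x) (index y - 1)
    (index y)
  obtain ⟨l', hl'⟩ := exists_ne_of_five_lt hm (index y - 2) (index y - 1) (index y) (index x - 1)
    (index x)
  obtain ⟨l'', hl''⟩ := exists_ne_of_five_lt hm (index y - 1) (index y) (index y + 1) (index x - 1)
    (index x)
  rcases x with i | i | i | _ | _ <;> rcases y with j | j | j | _ | _ <;>
    simp only [index, ne_eq, not_true_eq_false, or_self] at hl hl' hl'' hx hy hxy <;>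
    first
    | (use l; simp only [third]; grind)
    | (use l'; simp only [third]; grind)
    | (use l''; simp only [third]; grind)

theorem exists_third_b_c_eq_none (hm : 5 < m) {x y : Letter (ZMod m)} (hx : x ≠ e) (hy : y ≠ e)
    (hxy : x ≠ d ∨ y ≠ d) :
    ∃ l, third x (b l) = none ∧ third y (c (l + 1)) = none ∨
      third y (b l) = none ∧ third x (c (l + 1)) = none := by
  obtain ⟨l, hl⟩ := exists_ne_of_five_lt hm (index x - 1) (index x) (index x + 1) (index y - 1)
    (index y)
  obtain ⟨l', hl'⟩ := exists_ne_of_five_lt hm (index y - 1) (index y) (index y + 1) (index x - 1)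
    (index x)
  obtain ⟨l'', hl''⟩ := exists_ne_of_five_lt hm (index y - 2) (index y - 1) (index y)
    (index x - 1) (index x)
  rcases x with i | i | i | _ | _ <;> rcases y with j | j | j | _ | _ <;>
    simp only [index, ne_eq, not_true_eq_false, or_self] at hl hl' hl'' hx hy hxy <;>
    first
    | (use l; simp only [third]; grind)
    | (use l'; simp only [third]; grind)
    | (use l''; simp only [third]; grind)

section LocalModel

/-- The letters `a j`, `b j` and `c j` with `|j| ≤ n`. -/
noncomputable def window (n : ℕ) : Finset (Letter ℤ) :=
  (Finset.Icc (-n : ℤ) n).biUnion fun j => {a j, b j, c j}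

/-- The letters of `window n`, and `d` and `e`. -/
noncomputable def near (n : ℕ) : Finset (Letter ℤ) :=
  window n ∪ {d, e}

theorem a_mem_near {n : ℕ} {j : ℤ} : a j ∈ near n ↔ -n ≤ j ∧ j ≤ n := by
  simp [near, window]

theorem b_mem_near {n : ℕ} {j : ℤ} : b j ∈ near n ↔ -n ≤ j ∧ j ≤ n := by
  simp [near, window]

theorem c_mem_near {n : ℕ} {j : ℤ} : c j ∈ near n ↔ -n ≤ j ∧ j ≤ n := by
  simp [near, window]

theorem near_mono {n n' : ℕ} (h : n ≤ n') : near n ⊆ near n' :=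
  Finset.union_subset_union_left <| Finset.biUnion_subset_biUnion_of_subset_left _ <|
    Finset.Icc_subset_Icc (by omega) (by omega)

/-- The hypotheses of `IsDualCubic.vanishes_of_slide` for `z`, `w` with indices in `[-1, 1]`. -/
def Slides (Q : Letter ℤ → Letter ℤ → Letter ℤ → Prop) (x y p : Letter ℤ) : Prop :=
  ∃ z ∈ near 1, ∃ w ∈ near 1, third z w = some p ∧ third y z = none ∧
    ∀ u ∈ third x w, Q y z u

/-- At most `n` slides show that the products `x y * q`, where `q` has the complement `p` in the
cubic, lie in the square of the annihilator. -/
def VanishesIn : ℕ → Letter ℤ → Letter ℤ → Letter ℤ → Prop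
  | 0, _, _, _ => False
  | n + 1, x, y, p => Slides (VanishesIn n) x y p ∨ Slides (VanishesIn n) y x p

noncomputable instance VanishesIn.decidable :
    (n : ℕ) → (x y p : Letter ℤ) → Decidable (VanishesIn n x y p)
  | 0, _, _, _ => inferInstanceAs (Decidable False)
  | n + 1, _, _, _ =>
    have := VanishesIn.decidable n
    by unfold VanishesIn Slides; infer_instance

theorem vanishesIn_three :
    ∀ p ∈ window 0, ∀ x ∈ near 2, ∀ y ∈ near 2, third x y = none → x ≠ p → y ≠ p →
      VanishesIn 3 x y p := by
  decide +kernel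

theorem exists_third_eq_of_mem_near :
    ∀ p ∈ window 0, ∀ y ∈ near 2, y ≠ p →
      ∃ z ∈ window 1, ∃ w ∈ window 1, third z w = some p ∧ third y z = none := by
  decide +kernel

/-- Some two of the four letters occur together in no term. -/
def Unrelated {R : Type*} [Ring R] [DecidableEq R] (x y z w : Letter R) : Prop :=
  third x y = none ∨ third x z = none ∨ third x w = none ∨
    third y z = none ∨ third y w = none ∨ third z w = none

/-- The hypotheses of `IsDualCubic.quad_exchange_mem`, such that the property `Q` holds for the
three quartics exchanged for `x y z w`. -/
def Exchanges (Q : Letter ℤ → Letter ℤ → Letter ℤ → Letter ℤ → Prop) (x y z w : Letter ℤ) : Prop :=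
  ∃ x' ∈ near 2, ∃ y' ∈ near 2, third x y = third x' y' ∧ Q x' y' z w ∧
    ∃ z' ∈ near 2, ∃ w' ∈ near 2, third z w = third z' w' ∧ Q x y z' w' ∧ Q x' y' z' w'

/-- At most `n` rounds of exchanges reduce the quartic `x y z w` to quartics with two letters that
occur together in no term. -/
def ReducesIn : ℕ → Letter ℤ → Letter ℤ → Letter ℤ → Letter ℤ → Prop
  | 0, x, y, z, w => Unrelated x y z w
  | n + 1, x, y, z, w => ReducesIn n x y z w ∨ Exchanges (ReducesIn n) x y z w ∨
      Exchanges (ReducesIn n) x z y w ∨ Exchanges (ReducesIn n) x w y z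

noncomputable instance ReducesIn.decidable :
    (n : ℕ) → (x y z w : Letter ℤ) → Decidable (ReducesIn n x y z w)
  | 0, _, _, _, _ => by unfold ReducesIn Unrelated; infer_instance
  | n + 1, _, _, _, _ =>
    have := ReducesIn.decidable n
    by unfold ReducesIn Exchanges; infer_instance

theorem reducesIn_two :
    ∀ x ∈ window 0, ∀ y ∈ near 1, ∀ z ∈ near 1, ∀ w ∈ near 1, ReducesIn 2 x y z w := by
  decide +kernel

end LocalModel

section Place

variable {n : ℕ} (i : ZMod m)

/-- The letter whose index is `i` plus that of a letter with an integral index. -/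
def place : Letter ℤ → Letter (ZMod m)
  | a j => a (i + j)
  | b j => b (i + j)
  | c j => c (i + j)
  | d => d
  | e => e

theorem intCast_eq_zero_iff {j : ℤ} (hj : |j| < m) : (j : ZMod m) = 0 ↔ j = 0 := by
  refine ⟨fun h => ?_, fun h => by simp [h]⟩
  exact Int.eq_zero_of_abs_lt_dvd ((ZMod.intCast_zmod_eq_zero_iff_dvd j m).1 h) hj

theorem third_place (hm : 5 < m) {x y : Letter ℤ} (hx : x ∈ near 2) (hy : y ∈ near 2) :
    third (place i x) (place i y) = (third x y).map (place i) := by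
  have add_eq_iff {j l : ℤ} (hj : -(2 : ℕ) ≤ j ∧ j ≤ (2 : ℕ))
      (hl : -(2 : ℕ) ≤ l ∧ l ≤ (2 : ℕ)) :
      (i + (j : ZMod m) = i + l ↔ j = l) ∧ (i + (j : ZMod m) = i + l + 1 ↔ j = l + 1) := by
    rw [add_assoc, add_right_inj, add_right_inj, ← sub_eq_zero,
      ← sub_eq_zero (b := (l + 1 : ZMod m))]
    rw [← Int.cast_sub, ← Int.cast_one, ← Int.cast_add, ← Int.cast_sub,
      intCast_eq_zero_iff (by rw [abs_lt]; omega), intCast_eq_zero_iff (by rw [abs_lt]; omega),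
      sub_eq_zero, sub_eq_zero]
    exact ⟨Iff.rfl, Iff.rfl⟩
  rcases x with j | j | j | _ | _ <;> rcases y with l | l | l | _ | _ <;>
    first
    | (simp only [a_mem_near, b_mem_near, c_mem_near] at hx hy
       simp only [third, place, add_eq_iff hx hy, add_eq_iff hy hx]
       split_ifs <;> simp [place, add_sub_assoc])
    | simp [third, place, add_assoc, add_sub_assoc]

theorem exists_mem_near_of_index_eq {y : Letter (ZMod m)} {j : ℤ} (hj : -n ≤ j ∧ j ≤ n)
    (h : index y = i + j) : ∃ y' ∈ near n, place i y' = y := by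
  cases y with
  | a l => exact ⟨a j, a_mem_near.2 hj, congrArg a h.symm⟩
  | b l => exact ⟨b j, b_mem_near.2 hj, congrArg b h.symm⟩
  | c l => exact ⟨c j, c_mem_near.2 hj, congrArg c h.symm⟩
  | d => exact ⟨d, by simp [near], rfl⟩
  | e => exact ⟨e, by simp [near], rfl⟩

theorem index_eq_of_third_ne_none {x y : Letter (ZMod m)} (h : third x y ≠ none) :
    (x = d ∨ x = e) ∨ (y = d ∨ y = e) ∨
      index y = index x ∨ index y = index x + 1 ∨ index y = index x - 1 := by
  rcases x with l | l | l | _ | _ <;> rcases y with l' | l' | l' | _ | _ <;>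
    simp only [third, index] at h ⊢ <;> grind

theorem exists_mem_near_of_third_ne_none {x : Letter ℤ} {y : Letter (ZMod m)} (hx : x ∈ window n)
    (h : third (place i x) y ≠ none) : ∃ y' ∈ near (n + 1), place i y' = y := by
  obtain ⟨j, hj, hx⟩ : ∃ j : ℤ, (-n ≤ j ∧ j ≤ n) ∧ (x = a j ∨ x = b j ∨ x = c j) := by
    simpa [window] using hx
  have index_x : index (place i x) = i + j := by rcases hx with rfl | rfl | rfl <;> rfl
  obtain (hd | he) | (rfl | rfl) | hy := index_eq_of_third_ne_none h
  · rcases hx with rfl | rfl | rfl <;> simp [place] at hd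
  · rcases hx with rfl | rfl | rfl <;> simp [place] at he
  · exact ⟨d, by simp [near], rfl⟩
  · exact ⟨e, by simp [near], rfl⟩
  · rw [index_x] at hy
    rcases hy with hy | hy | hy
    · exact exists_mem_near_of_index_eq i (j := j) (by grind) (by rw [hy])
    · exact exists_mem_near_of_index_eq i (j := j + 1) (by grind) (by grind)
    · exact exists_mem_near_of_index_eq i (j := j - 1) (by grind) (by grind)

theorem exists_place_eq {x : Letter (ZMod m)} (hd : x ≠ d) (he : x ≠ e) :
    ∃ i, ∃ y ∈ window 0, place i y = x := by
  rcases x with i | i | i | _ | _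
  · exact ⟨i, a 0, by simp [window], by simp [place]⟩
  · exact ⟨i, b 0, by simp [window], by simp [place]⟩
  · exact ⟨i, c 0, by simp [window], by simp [place]⟩
  · exact absurd rfl hd
  · exact absurd rfl he

end Place

end Letter

namespace IsDualCubic

open Letter

variable {σ k : Type*} [Field k] {m n : ℕ} {v : Letter (ZMod m) ≃ σ} {f : DividedPower σ k}
  {x y z w p : Letter (ZMod m)} (hf : IsDualCubic v third f)

include hf

theorem vanishes_place (hm : 5 < m) (i : ZMod m) {x y p : Letter ℤ} (hx : x ∈ near 2)
    (hy : y ∈ near 2) (hxy : third (place i x) (place i y) = none) (h : VanishesIn n x y p) :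
    Vanishes v third f (place i x) (place i y) (place i p) := by
  induction n generalizing x y p with
  | zero => exact h.elim
  | succ n ih =>
    have of_slides {x y : Letter ℤ} (hx : x ∈ near 2) (hy : y ∈ near 2)
        (hxy : third (place i x) (place i y) = none) (h : Slides (VanishesIn n) x y p) :
        Vanishes v third f (place i x) (place i y) (place i p) := by
      obtain ⟨z, hz, w, hw, hzw, hyz, h⟩ := h
      replace hz := near_mono one_le_two hz
      replace hw := near_mono one_le_two hw
      replace hyz : third (place i y) (place i z) = none := by
        rw [third_place i hm hy hz, hyz, Option.map_none]
      refine hf.vanishes_of_slide hxy (z := place i z) (w := place i w) ?_ hyz fun u hu => ?_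
      · rw [third_place i hm hz hw, hzw, Option.map_some]
      · rw [third_place i hm hx hw, Option.mem_map] at hu
        obtain ⟨u, hu, rfl⟩ := hu
        exact ih hy hz hyz (h u hu)
    obtain h | h := h
    · exact of_slides hx hy hxy h
    · exact (of_slides hy hx (hf.third_comm _ _ ▸ hxy) h).symm

theorem third_place_eq_none_of_far (i : ZMod m) {z : Letter ℤ} (hz : z ∈ window 1)
    (hfar : ¬ ∃ x' ∈ near 2, place i x' = x) : third x (place i z) = none := by
  rw [hf.third_comm]
  exact not_not.1 (mt (exists_mem_near_of_third_ne_none i hz) hfar)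

theorem exists_window_third_eq (hm : 5 < m) (i : ZMod m) {p : Letter ℤ} (hp : p ∈ window 0)
    (hy : y ≠ place i p) :
    ∃ z ∈ window 1, ∃ w ∈ window 1, third z w = some p ∧ third y (place i z) = none := by
  by_cases hy' : ∃ y' ∈ near 2, place i y' = y
  · obtain ⟨y, hy', rfl⟩ := hy'
    obtain ⟨z, hz, w, hw, hzw, hyz⟩ :=
      exists_third_eq_of_mem_near p hp y hy' (ne_of_apply_ne _ hy)
    have hz' := near_mono one_le_two (Finset.mem_union_left _ hz)
    exact ⟨z, hz, w, hw, hzw, by rw [third_place i hm hy' hz', hyz, Option.map_none]⟩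
  · have hep : .e ≠ p := by
      rintro rfl
      simp [window] at hp
    obtain ⟨z, hz, w, hw, hzw, -⟩ :=
      exists_third_eq_of_mem_near p hp .e (by simp [near]) hep
    exact ⟨z, hz, w, hw, hzw, hf.third_place_eq_none_of_far i hz hy'⟩

theorem vanishes_of_ne_d_of_ne_e (hm : 5 < m) (hd : p ≠ .d) (he : p ≠ .e) (hxy : third x y = none)
    (hx : x ≠ p) (hy : y ≠ p) : Vanishes v third f x y p := by
  obtain ⟨i, p, hp, rfl⟩ := exists_place_eq hd he
  have of_far {x y : Letter (ZMod m)} (hxy : third x y = none) (hy : y ≠ place i p)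
      (hfar : ¬ ∃ x' ∈ near 2, place i x' = x) : Vanishes v third f x y (place i p) := by
    obtain ⟨z, hz, w, hw, hzw, hyz⟩ := hf.exists_window_third_eq hm i hp hy
    refine hf.vanishes_of_third_eq_none hxy (z := place i z) (w := place i w) ?_ hyz
      (hf.third_place_eq_none_of_far i hw hfar)
    rw [third_place i hm, hzw, Option.map_some]
    exacts [near_mono one_le_two (Finset.mem_union_left _ hz),
      near_mono one_le_two (Finset.mem_union_left _ hw)]
  by_cases hx' : ∃ x' ∈ near 2, place i x' = x
  · by_cases hy' : ∃ y' ∈ near 2, place i y' = y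
    · obtain ⟨x, hx', rfl⟩ := hx'
      obtain ⟨y, hy', rfl⟩ := hy'
      refine hf.vanishes_place hm i hx' hy' hxy (vanishesIn_three p hp x hx' y hy' ?_
        (ne_of_apply_ne _ hx) (ne_of_apply_ne _ hy))
      rwa [third_place i hm hx' hy', Option.map_eq_none_iff] at hxy
    · exact (of_far (hf.third_comm x y ▸ hxy) hx hy').symm
  · exact of_far hxy hy hx'

theorem vanishes_d (hm : 5 < m) (hxy : third x y = none) (hx : x ≠ .d) (hy : y ≠ .d) :
    Vanishes v third f x y .d := by
  by_cases hxye : x = .e ∧ y = .e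
  · obtain ⟨rfl, rfl⟩ := hxye
    refine hf.vanishes_of_slide hxy (third_a_b_add_one (by omega) 0) rfl fun u hu => ?_
    obtain rfl : .c (0 + 1 + 1) = u := by simpa [third] using hu
    exact hf.vanishes_of_ne_d_of_ne_e hm nofun nofun rfl nofun nofun
  · obtain ⟨l, ⟨ha, hb⟩ | ⟨ha, hb⟩⟩ :=
      exists_third_a_b_eq_none hm hx hy (not_and_or.1 hxye)
    all_goals have hab := third_a_b_add_one (by omega) l
    · exact (hf.vanishes_of_third_eq_none (hf.third_comm x y ▸ hxy) hab ha hb).symm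
    · exact hf.vanishes_of_third_eq_none hxy hab ha hb

theorem vanishes_e (hm : 5 < m) (hxy : third x y = none) (hx : x ≠ .e) (hy : y ≠ .e) :
    Vanishes v third f x y .e := by
  by_cases hxyd : x = .d ∧ y = .d
  · obtain ⟨rfl, rfl⟩ := hxyd
    refine hf.vanishes_of_slide hxy (hf.third_comm _ _ ▸ third_b_c_add_one (by omega) 0) rfl
      fun u hu => ?_
    obtain rfl : .a (0 - 1) = u := by simpa [third] using hu
    exact hf.vanishes_of_ne_d_of_ne_e hm nofun nofun rfl nofun nofun
  · obtain ⟨l, ⟨hb, hc⟩ | ⟨hb, hc⟩⟩ :=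
      exists_third_b_c_eq_none hm hx hy (not_and_or.1 hxyd)
    all_goals have hbc := third_b_c_add_one (by omega) l
    · exact (hf.vanishes_of_third_eq_none (hf.third_comm x y ▸ hxy) hbc hb hc).symm
    · exact hf.vanishes_of_third_eq_none hxy hbc hb hc

theorem vanishes (hm : 5 < m) (hxy : third x y = none) (hx : x ≠ p) (hy : y ≠ p) :
    Vanishes v third f x y p := by
  by_cases hd : p = .d
  · subst hd
    exact hf.vanishes_d hm hxy hx hy
  by_cases he : p = .e
  · subst he
    exact hf.vanishes_e hm hxy hx hy
  exact hf.vanishes_of_ne_d_of_ne_e hm hd he hxy hx hy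

theorem quad_mem_reach_of_imp_ne (hm : 5 < m) (hxy : third x y = none)
    (h : third z w = some x → x ≠ y) :
    quad k v x y z w ∈ reach v third f := by
  have of_third_eq {x y : Letter (ZMod m)} (hyx : third y x = none) (hne : x ≠ y)
      (hzw : third z w = some x) : quad k v y x z w ∈ reach v third f :=
    Submodule.mem_sup_right <| Submodule.subset_span <|
      Set.mem_iUnion.2 ⟨y, x, z, w, hyx, hne, hzw, rfl⟩
  cases hzw : third z w with
  | none => exact Submodule.mem_sup_left (hf.quad_mem hxy hzw)
  | some p =>
    obtain rfl | hx := eq_or_ne x p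
    · rw [quad_swap_left]
      exact of_third_eq (hf.third_comm x y ▸ hxy) (h hzw) hzw
    obtain rfl | hy := eq_or_ne y p
    · exact of_third_eq hxy hx.symm hzw
    exact Submodule.mem_sup_left (hf.vanishes hm hxy hx hy z w hzw)

theorem quad_d_d_mem_reach (hm : 5 < m) (hzw : third z w = some .d) :
    quad k v .d .d z w ∈ reach v third f := by
  have h1 : (1 : ZMod m) ≠ 0 := mod_cast natCast_ne_zero one_pos (by omega)
  have h2 : (2 : ZMod m) ≠ 0 := mod_cast natCast_ne_zero (n := 2) two_pos (by omega)
  have h21 : (2 : ZMod m) ≠ 1 := fun h => h1 (by linear_combination h)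
  have had : third .d (.a (0 : ZMod m)) = third (.c 2) .e := by simp [third]; ring
  have hbd : third .d (.b (1 : ZMod m)) = third (.b 0) (.c 0) := by simp [third]
  have hcb : third (.c (2 : ZMod m)) (.b 0) = none := by simp [third, h2.symm, h21]
  refine mem_reach_of_sub_mem (hf.quad_sub_mem rfl
    (hzw.trans (third_a_b_add_one (by omega) 0).symm)) ?_
  rw [zero_add, quad_swap_mid]
  refine hf.quad_mem_reach_of_exchange had hbd ?_ ?_ ?_
  · rw [quad_swap_mid]
    exact hf.quad_mem_reach_of_imp_ne hm rfl fun _ => nofun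
  · rw [quad_swap_right, quad_swap_mid]
    exact hf.quad_mem_reach_of_imp_ne hm rfl fun _ => nofun
  · rw [quad_swap_mid]
    exact hf.quad_mem_reach_of_imp_ne hm hcb fun _ => nofun

theorem quad_e_e_mem_reach (hm : 5 < m) (hzw : third z w = some .e) :
    quad k v .e .e z w ∈ reach v third f := by
  have h1 : (1 : ZMod m) ≠ 0 := mod_cast natCast_ne_zero one_pos (by omega)
  have h2 : (2 : ZMod m) ≠ 0 := mod_cast natCast_ne_zero (n := 2) two_pos (by omega)
  have h11 : (-1 : ZMod m) ≠ 1 := fun h => h2 (by linear_combination -h)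
  have hbe : third .e (.b (0 : ZMod m)) = third (.a 1) (.b 1) := by simp [third]
  have hce : third .e (.c (1 : ZMod m)) = third (.a (-1)) .d := by simp [third]
  have hba : third (.b (1 : ZMod m)) (.a (-1)) = none := by simp [third, h1, h11]
  refine mem_reach_of_sub_mem (hf.quad_sub_mem rfl
    (hzw.trans (third_b_c_add_one (by omega) 0).symm)) ?_
  rw [zero_add, quad_swap_mid]
  refine hf.quad_mem_reach_of_exchange hbe hce ?_ ?_ ?_
  · rw [quad_swap_mid]
    exact hf.quad_mem_reach_of_imp_ne hm rfl fun _ => nofun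
  · rw [quad_swap_mid]
    exact hf.quad_mem_reach_of_imp_ne hm rfl fun _ => nofun
  · rw [quad_swap_left, quad_swap_mid]
    exact hf.quad_mem_reach_of_imp_ne hm hba fun _ => nofun

theorem quad_mem_reach_of_third_eq_none (hm : 5 < m) (hxy : third x y = none) :
    quad k v x y z w ∈ reach v third f := by
  by_cases h : third z w = some x ∧ x = y
  · obtain ⟨hzw, rfl⟩ := h
    cases x with
    | d => exact hf.quad_d_d_mem_reach hm hzw
    | e => exact hf.quad_e_e_mem_reach hm hzw
    | _ =>
      simp only [third] at hxy
      split_ifs at hxy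
  · exact hf.quad_mem_reach_of_imp_ne hm hxy (not_and.1 h)

theorem quad_mem_reach_of_unrelated (hm : 5 < m) (h : Unrelated x y z w) :
    quad k v x y z w ∈ reach v third f := by
  obtain h | h | h | h | h | h := h
  · exact hf.quad_mem_reach_of_third_eq_none hm h
  · rw [quad_swap_mid]
    exact hf.quad_mem_reach_of_third_eq_none hm h
  · rw [quad_swap_right, quad_swap_mid]
    exact hf.quad_mem_reach_of_third_eq_none hm h
  · rw [quad_swap_left, quad_swap_mid]
    exact hf.quad_mem_reach_of_third_eq_none hm h
  · rw [quad_swap_left, quad_swap_right, quad_swap_mid]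
    exact hf.quad_mem_reach_of_third_eq_none hm h
  · rw [quad, mul_comm]
    exact hf.quad_mem_reach_of_third_eq_none hm h

theorem quad_place_mem_reach (hm : 5 < m)
    (i : ZMod m) {x y z w : Letter ℤ} (hx : x ∈ near 2) (hy : y ∈ near 2) (hz : z ∈ near 2)
    (hw : w ∈ near 2) (h : ReducesIn n x y z w) :
    quad k v (place i x) (place i y) (place i z) (place i w) ∈ reach v third f := by
  induction n generalizing x y z w with
  | zero =>
    refine hf.quad_mem_reach_of_unrelated hm ?_
    simpa only [ReducesIn, Unrelated, third_place i hm, hx, hy, hz, hw,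
      Option.map_eq_none_iff] using h
  | succ n ih =>
    have of_exchanges {x y z w : Letter ℤ} (hx : x ∈ near 2) (hy : y ∈ near 2) (hz : z ∈ near 2)
        (hw : w ∈ near 2) (h : Exchanges (ReducesIn n) x y z w) :
        quad k v (place i x) (place i y) (place i z) (place i w) ∈ reach v third f := by
      obtain ⟨x', hx', y', hy', hxy, h₁, z', hz', w', hw', hzw, h₂, h₃⟩ := h
      refine hf.quad_mem_reach_of_exchange ?_ ?_ (ih hx' hy' hz hw h₁) (ih hx hy hz' hw' h₂)
        (ih hx' hy' hz' hw' h₃)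
      · rw [third_place i hm hx hy, third_place i hm hx' hy', hxy]
      · rw [third_place i hm hz hw, third_place i hm hz' hw', hzw]
    obtain h | h | h | h := h
    · exact ih hx hy hz hw h
    · exact of_exchanges hx hy hz hw h
    · rw [quad_swap_mid]
      exact of_exchanges hx hz hy hw h
    · rw [quad_swap_right, quad_swap_mid]
      exact of_exchanges hx hw hy hz h

theorem quad_mem_reach_of_ne_d_of_ne_e (hm : 5 < m) (hd : x ≠ .d) (he : x ≠ .e) :
    quad k v x y z w ∈ reach v third f := by
  by_cases h : third x y = none ∨ third x z = none ∨ third x w = none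
  · exact hf.quad_mem_reach_of_unrelated hm (by unfold Unrelated; tauto)
  obtain ⟨hxy, hxz, hxw⟩ := (by simpa only [not_or] using h : _ ∧ _ ∧ _)
  obtain ⟨i, x, hx, rfl⟩ := exists_place_eq hd he
  obtain ⟨y, hy, rfl⟩ := exists_mem_near_of_third_ne_none i hx hxy
  obtain ⟨z, hz, rfl⟩ := exists_mem_near_of_third_ne_none i hx hxz
  obtain ⟨w, hw, rfl⟩ := exists_mem_near_of_third_ne_none i hx hxw
  exact hf.quad_place_mem_reach hm i (near_mono zero_le_two (Finset.mem_union_left _ hx))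
    (near_mono one_le_two hy) (near_mono one_le_two hz) (near_mono one_le_two hw)
    (reducesIn_two x hx y hy z hz w hw)

theorem quad_mem_reach (hm : 5 < m) (x y z w : Letter (ZMod m)) :
    quad k v x y z w ∈ reach v third f := by
  by_cases hxy : third x y = none
  · exact hf.quad_mem_reach_of_third_eq_none hm hxy
  by_cases hx : x = .d ∨ x = .e
  · rw [quad_swap_left]
    apply hf.quad_mem_reach_of_ne_d_of_ne_e hm
    all_goals
      rintro rfl
      obtain rfl | rfl := hx <;> exact hxy rfl
  · exact hf.quad_mem_reach_of_ne_d_of_ne_e hm (not_or.1 hx).1 (not_or.1 hx).2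

theorem exists_star_mul_mem (hm : 5 < m) (x y : Letter (ZMod m)) :
    ∃ s ∈ stars k v third y, X (v x) * s ∈ Ann f ^ 2 := by
  obtain ⟨p, hp, hxp, hyp⟩ := exists_third_eq_none_of_pair hm x y
  obtain ⟨q, r, hqr⟩ := exists_third_eq (by omega) p
  exact ⟨_, ⟨p, q, r, hyp, hp, hqr, rfl⟩, hf.X_mul_quad_mem hqr hxp hp⟩

end IsDualCubic

theorem smallTangentSpaceCondition_cubicF'' (k : Type*) [Field k] (m : ℕ) [NeZero m] (hm : 5 < m) :
    SmallTangentSpaceCondition (dualElement (cubicF'' k m)) := by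
  have h1 : (1 : ZMod m) ≠ 0 := mod_cast Letter.natCast_ne_zero one_pos (by omega)
  have h2 : (2 : ZMod m) ≠ 0 := mod_cast Letter.natCast_ne_zero (n := 2) two_pos (by omega)
  have hf := Letter.isDualCubic_cubicF'' (k := k) h1 h2
  have : Nonempty (Letter (ZMod m)) := ⟨.d⟩
  have hpair := Letter.exists_third_eq (m := m) (by omega)
  refine hf.smallTangentSpaceCondition hpair (fun y s hs s' hs' => ?_) (hf.quad_mem_reach hm)
    (hf.exists_star_mul_mem hm)
  obtain ⟨o, ho⟩ := Letter.exists_reflTransGen_step (by omega) y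
  exact hf.stars_sub_mem hpair ho hs hs'

end Apolarity

theorem mainTheorem6 (k : Type*) [Field k] (m : ℕ) [NeZero m] (hm : 6 ≤ m) :
    Nat.card (Apolarity.Var m) = 3 * m + 2 ∧
      Apolarity.SmallTangentSpaceCondition
        (Apolarity.dualElement (Apolarity.cubicF'' k m)) :=
  ⟨Apolarity.card_Var m, Apolarity.smallTangentSpaceCondition_cubicF'' k m hm⟩
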